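/- Let $k:\mathbb{R}\times\mathbb{R}\to\mathbb{R}$ be a measurable kernel of a reproducing kernel Hilbert space (symmetric and positive semidefinite), bounded above, and let $K_0:=\sup_{x,y}k(x,y)<\infty$. For probability densities $f_1,f_2$ on $\mathbb{R}$ put $$\mathrm{MMD}^2(f_1,f_2)=\mathsf{E}[k(X,X')]-2\,\mathsf{E}[k(X,Y)]+\mathsf{E}[k(Y,Y')],$$ with $X,X'\sim f_1$ and $Y,Y'\sim f_2$ independent, and for samples $x=(x_1,\dots,x_{n_1})$, $y=(y_1,\dots,y_{n_2})$ put $$\mathrm{MMD}^2(x,y)=\frac{1}{n_1(n_1-1)}\sum_{i\ne j}k(x_i,x_j)+\frac{1}{n_2(n_2-1)}\sum_{i\neq j}k(y_i,y_j)-\frac{2}{n_1n_2}\sum_{i,j}k(x_i,y_j).$$ Let $M,T$ be integers with $1\le T\le\lceil M/2\rceil-1$ (in particular one may take $T=\lceil M/2\rceil-1\geq 1$), and let $\mathcal{C}_t$ be the set of all $t$-element subsets of $[M]=\{1,\dots,M\}$. Given $M$ real sequences $\mathbf{y}^n=(y_1^n,\dots,y_M^n)$ of length $n$, define for $1\le t\le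 T$ and $\mathcal{D}\in\mathcal{C}_t$ $$\mathrm{G}_{\mathcal{D}}(\mathbf{y}^n)=\max_{j\notin\mathcal{D}}\mathrm{MMD}^2\big(y_j^n,\bar{\mathbf{y}}^n_{\mathcal{D},j}\big),$$ where $\bar{\mathbf{y}}^n_{\mathcal{D},j}$ is the pooled sample of all $y_i^n$ with $i\notin\mathcal{D}$, $i\ne j$. Let $\mathcal{I}_t^*(\mathbf{y}^n)\in\mathcal{C}_t$ be a minimizer of $\mathrm{G}_{\mathcal{D}}(\mathbf{y}^n)$ over $\mathcal{D}\in\mathcal{C}_t$ (ties broken in an arbitrary way) and let $h_t(\mathbf{y}^n)=\min\{\mathrm{G}_{\mathcal{D}}(\mathbf{y}^n):\mathcal{D}\in\mathcal{C}_t,\ \mathcal{D}\ne\mathcal{I}_t^*(\mathbf{y}^n)\}$ be the second smallest score. For $\lambda>0$, the fixed-length test $\phi_n$ estimates the number of outliers by $\hat s$, the largest $t\in\{1,\dots,T\}$ with $h_t(\mathbf{y}^n)>\lambda$, and $\hat s=0$ if there is no such $t$. If $\hat s=0$ it decides $\mathrm{H}_{\mathrm r}$ (no outlier); otherwise it decides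 that $\mathcal{I}^*_{\hat s}(\mathbf{y}^n)$ is the set of outliers. Let $f_{\mathrm N},f_{\mathrm A}$ be arbitrary probability densities on $\mathbb{R}$. For $\mathcal{B}\subseteq[M]$ let $\mathbb{P}_{\mathcal{B}}$ be the law of $M$ independent sequences $\mathbf{Y}^n$, the $j$-th of which is i.i.d. from $f_{\mathrm A}$ if $j\in\mathcal{B}$ and i.i.d. from $f_{\mathrm N}$ if $j\notin\mathcal{B}$. Let $$\beta_{\mathcal{B}}(\phi_n)=\mathbb{P}_{\mathcal{B}}\{\phi_n(\mathbf{Y}^n)\notin\{\mathcal{B},\mathrm{H}_{\mathrm r}\}\},\quad \zeta_{\mathcal{B}}(\phi_n)=\mathbb{P}_{\mathcal{B}}\{\phi_n(\mathbf{Y}^n)=\mathrm{H}_{\mathrm r}\},\quad \mathrm{P}_{\mathrm{FA}}(\phi_n)=\mathbb{P}_{\emptyset}\{\phi_n(\mathbf{Y}^n)\ne\mathrm{H}_{\mathrm r}\}$$ be the misclassification, false reject and false alarm probabilities. For $1\le s\le T$ define $$g_1(\lambda)=\frac{\lambda^2}{32K_0^2\left(1+\frac1{M-T-1}\right)},\qquad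 g_2(\lambda)=\frac{\left(\left(1-\frac{s}{M-s-1}\right)^2\mathrm{MMD}^2(f_{\mathrm N},f_{\mathrm A})-\lambda\right)^2}{32K_0^2\left(1+\frac1{M-s-1}\right)}.$$ Then for every $\lambda>0$ (with $-\log 0=+\infty$): 1. If $1<s\le T$ and $\lambda<\left(1-\frac{s}{M-s-1}\right)^2\mathrm{MMD}^2(f_{\mathrm N},f_{\mathrm A})$, then for each $\mathcal{B}\in\mathcal{C}_s$ $$\liminf_{n\to\infty}-\tfrac1n\log\beta_{\mathcal{B}}(\phi_n)\ge\min\{g_1(\lambda),g_2(\lambda)\},\qquad \liminf_{n\to\infty}-\tfrac1n\log\zeta_{\mathcal{B}}(\phi_n)\ge g_2(\lambda).$$ 2. If $s=1$ and $\lambda<\mathrm{MMD}^2(f_{\mathrm N},f_{\mathrm A})$, then for each $\mathcal{B}\in\mathcal{C}_1$ $$\liminf_{n\to\infty}-\tfrac1n\log\beta_{\mathcal{B}}(\phi_n)\ge g_1(\lambda),\qquad \liminf_{n\to\infty}-\tfrac1n\log\zeta_{\mathcal{B}}(\phi_n)\ge\frac{\left(\mathrm{MMD}^2(f_{\mathrm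 N},f_{\mathrm A})-\lambda\right)^2}{32K_0^2\left(1+\frac1{M-2}\right)}.$$ 3. The false alarm probability satisfies $$\liminf_{n\to\infty}-\tfrac1n\log\mathrm{P}_{\mathrm{FA}}(\phi_n)\ge g_1(\lambda).$$ -/

import Mathlib

open MeasureTheory Filter

namespace OutlierTest

noncomputable section

/-! ### Densities and the maximum mean discrepancy -/

/-- `f` is a probability density function on the real line. -/
structure IsPDF (f : ℝ → ℝ) : Prop where
  measurable : Measurable f
  nonneg : ∀ x, 0 ≤ f x
  lintegral_eq_one : ∫⁻ x, ENNReal.ofReal (f x) = 1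

/-- The distribution on the real line with density `f`. -/
def law (f : ℝ → ℝ) : Measure ℝ :=
  volume.withDensity fun x => ENNReal.ofReal (f x)

/-- `k` is a (measurable) kernel of a reproducing kernel Hilbert space of real functions on `ℝ`,
that is, it is symmetric and positive semidefinite, and `k` is bounded above. -/
structure IsBoundedKernel (k : ℝ → ℝ → ℝ) : Prop where
  measurable : Measurable (Function.uncurry k)
  posSemidef : (Matrix.of k).PosSemidef
  bddAbove : BddAbove (Set.range (Function.uncurry k))

/-- The largest value `K₀` of the kernel. -/
def kernelMax (k : ℝ → ℝ → ℝ) : ℝ :=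
  ⨆ p : ℝ × ℝ, k p.1 p.2

/-- The squared maximum mean discrepancy `E k(X,X') - 2 E k(X,Y) + E k(Y,Y')` of the two
distributions with densities `f₁` and `f₂`, where `X, X' ∼ f₁` and `Y, Y' ∼ f₂` are independent. -/
def mmdSq (k : ℝ → ℝ → ℝ) (f₁ f₂ : ℝ → ℝ) : ℝ :=
  (∫ p, k p.1 p.2 ∂((law f₁).prod (law f₁)))
    - 2 * (∫ p, k p.1 p.2 ∂((law f₁).prod (law f₂)))
    + ∫ p, k p.1 p.2 ∂((law f₂).prod (law f₂))

/-- The squared maximum mean discrepancy of two finite samples `x` and `y` (indexed by arbitrary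
finite types, the order of the entries being irrelevant):
`1/(n₁(n₁-1)) ∑_{i≠j} k(xᵢ,xⱼ) + 1/(n₂(n₂-1)) ∑_{i≠j} k(yᵢ,yⱼ) - 2/(n₁n₂) ∑_{i,j} k(xᵢ,yⱼ)`. -/
def sampleMMDSq (k : ℝ → ℝ → ℝ) {ι κ : Type} [Fintype ι] [DecidableEq ι]
    [Fintype κ] [DecidableEq κ] (x : ι → ℝ) (y : κ → ℝ) : ℝ :=
  1 / ((Fintype.card ι : ℝ) * ((Fintype.card ι : ℝ) - 1)) *
      (∑ i, ∑ j, if i ≠ j then k (x i) (x j) else 0)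
    + 1 / ((Fintype.card κ : ℝ) * ((Fintype.card κ : ℝ) - 1)) *
      (∑ i, ∑ j, if i ≠ j then k (y i) (y j) else 0)
    - 2 / ((Fintype.card ι : ℝ) * (Fintype.card κ : ℝ)) *
      (∑ i, ∑ j, k (x i) (y j))

/-! ### Scores and the test

Data: `y i ℓ` is the `ℓ`-th entry of the `i`-th of `M` sequences of length `n`. -/

/-- The score `G_D`: the largest, over the sequences `j ∉ D`, discrepancy between the `j`-th
sequence and the pooled sequences outside `D ∪ {j}`.  (The supremum is over a finite family, which
is nonempty for `D ≠ univ`.) -/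
def score (k : ℝ → ℝ → ℝ) {M n : ℕ} (D : Finset (Fin M)) (y : Fin M → Fin n → ℝ) : ℝ :=
  ⨆ j : {j : Fin M // j ∉ D},
    sampleMMDSq k (y j.1) (fun p : {i : Fin M // i ∉ D ∧ i ≠ j.1} × Fin n => y p.1.1 p.2)

/-- The sets of `t` indices. -/
def setsOfSize (M t : ℕ) : Finset (Finset (Fin M)) :=
  Finset.powersetCard t Finset.univ

/-- `I` picks, for each size `t ∈ [1:T]` and all data, a set of size `t` of minimal score; ties may
be broken in any way. -/
def IsArgminScore (k : ℝ → ℝ → ℝ) {M n : ℕ} (T : ℕ)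
    (I : ℕ → (Fin M → Fin n → ℝ) → Finset (Fin M)) : Prop :=
  ∀ t ∈ Finset.Icc 1 T, ∀ y, I t y ∈ setsOfSize M t ∧ ∀ D ∈ setsOfSize M t, score k (I t y) y ≤ score k D y

/-- The second smallest score `h_t` among the sets of size `t`: the minimum over all sets of size
`t` other than the chosen minimizer.  (The infimum is over a finite family, which is nonempty for
`0 < t < M`, `2 ≤ M`.) -/
def secondScore (k : ℝ → ℝ → ℝ) {M n : ℕ}
    (I : ℕ → (Fin M → Fin n → ℝ) → Finset (Fin M)) (t : ℕ) (y : Fin M → Fin n → ℝ) : ℝ :=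
  ⨅ D : {D : Finset (Fin M) // D ∈ setsOfSize M t ∧ D ≠ I t y}, score k D.1 y

open Classical in
/-- The estimated number of outliers: the largest `t ∈ [1:T]` with `h_t > lam`, and `0` if there is
no such `t`. -/
def estimate (k : ℝ → ℝ → ℝ) {M n : ℕ} (T : ℕ) (lam : ℝ)
    (I : ℕ → (Fin M → Fin n → ℝ) → Finset (Fin M)) (y : Fin M → Fin n → ℝ) : ℕ :=
  ((Finset.Icc 1 T).filter fun t => lam < secondScore k I t y).sup id

/-- The fixed-length test.  The decision `none` is the null hypothesis (no outlier), the decision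
`some B` says that `B` is the set of outliers. -/
def test (k : ℝ → ℝ → ℝ) {M n : ℕ} (T : ℕ) (lam : ℝ)
    (I : ℕ → (Fin M → Fin n → ℝ) → Finset (Fin M)) (y : Fin M → Fin n → ℝ) :
    Option (Finset (Fin M)) :=
  if estimate k T lam I y = 0 then none else some (I (estimate k T lam I y) y)

/-! ### Error probabilities and exponents -/

/-- The distribution of the data when the sequences with index in `B` are i.i.d. from `fA`, the
others are i.i.d. from `fN`, and all are independent.  For `B = ∅` there is no outlier. -/
def dataLaw (fN fA : ℝ → ℝ) {M : ℕ} (n : ℕ) (B : Finset (Fin M)) :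
    Measure (Fin M → Fin n → ℝ) :=
  Measure.pi fun i => Measure.pi fun _ : Fin n => if i ∈ B then law fA else law fN

/-- Misclassification probability when `B` is the set of outliers. -/
def misclassification (fN fA : ℝ → ℝ) {M n : ℕ} (B : Finset (Fin M))
    (φ : (Fin M → Fin n → ℝ) → Option (Finset (Fin M))) : ENNReal :=
  dataLaw fN fA n B {y | φ y ≠ some B ∧ φ y ≠ none}

/-- False reject probability when `B` is the set of outliers. -/
def falseReject (fN fA : ℝ → ℝ) {M n : ℕ} (B : Finset (Fin M))
    (φ : (Fin M → Fin n → ℝ) → Option (Finset (Fin M))) : ENNReal :=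
  dataLaw fN fA n B {y | φ y = none}

/-- False alarm probability. -/
def falseAlarm (fN fA : ℝ → ℝ) {M n : ℕ}
    (φ : (Fin M → Fin n → ℝ) → Option (Finset (Fin M))) : ENNReal :=
  dataLaw fN fA n ∅ {y | φ y ≠ none}

/-- The exponent `liminf_{n → ∞} -(1/n) log p_n`, in the extended reals (with `log 0 = -∞`). -/
def exponent (p : ℕ → ENNReal) : EReal :=
  liminf (fun n : ℕ => -(ENNReal.log (p n)) / (n : EReal)) atTop

/-- The exponent function `g₁`. -/
def g₁ (k : ℝ → ℝ → ℝ) (M T : ℕ) (y : ℝ) : ℝ :=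
  y ^ 2 / (32 * kernelMax k ^ 2 * (1 + 1 / ((M : ℝ) - T - 1)))

/-- The exponent function `g₂`. -/
def g₂ (k : ℝ → ℝ → ℝ) (fN fA : ℝ → ℝ) (M s : ℕ) (y : ℝ) : ℝ :=
  ((1 - (s : ℝ) / ((M : ℝ) - s - 1)) ^ 2 * mmdSq k fN fA - y) ^ 2
    / (32 * kernelMax k ^ 2 * (1 + 1 / ((M : ℝ) - s - 1)))

end

end OutlierTest

open OutlierTest

/-!
The scores are maxima of sample discrepancies `pooledMMDSq k D j`, comparing the `j`-th sequence with
the pooled sequences outside `D ∪ {j}`. Each of these is a function of independent real variables.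
A positive semidefinite kernel satisfies `|k| ≤ K₀`, so changing one entry of a sample of size `n`
changes the discrepancy by at most `8 K₀ / n`. McDiarmid's lemma
(`HasBoundedDifferences.hasSubgaussianMGF`, obtained from Hoeffding's lemma by integrating out one
coordinate at a time) then makes `pooledMMDSq k D j` sub-Gaussian around its mean with variance proxy
`16 K₀² (1 + 1 / (M - |D| - 1)) / n`, which is where the constant `32 K₀²` of the exponents comes
from.

The means are computed exactly. If all the sequences involved are nominal the mean is `0`
(`IsBoundedKernel.integral_jointMMDSq_of_eq`). If `j` is an outlier and `r` of the `q` pooled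
sequences are outliers, the mean is `(1 - r / q) ^ 2 * MMD²` up to a term of order `1 / n`
(`IsBoundedKernel.integral_jointMMDSq_mixture`), without error term for `r = 0`.

Let `B` be the set of outliers. An error of the test forces one of two events.
* `nominalExceeds`: a discrepancy between nominal sequences exceeds the threshold. This happens when
  the number of outliers is overestimated, because at least two sets of any larger size `t < M`
  contain `B` and one of them is not the minimizer, and also when the size is right and the set is
  wrong. Its exponent is at least `g₁`.
* `wrongSetPasses`: a set `C ≠ B` of the size of `B` has score at most the threshold. This happens
  when the number of outliers is underestimated, in particular in a false reject. Such a `C` misses an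
  outlier `j`, and the pool of `j` has `r < s = |B|` outliers among `q = M - s - 1` sequences. As
  `(1 - r / q) ^ 2 > (1 - s / q) ^ 2`, for large `n` the mean exceeds `(1 - s / q) ^ 2 * MMD²`, so the
  error of order `1 / n` costs nothing and the exponent is at least `g₂`. For `s = 1` the pool is
  nominal and the mean is `MMD²` exactly.

Both events are unions of a number of events that does not depend on `n`, so the union bound does not
affect the exponents (`le_exponent`).
-/

namespace OutlierTest

open ProbabilityTheory
open scoped NNReal

/-! ### The bounded differences inequality -/

section BoundedDifferences

variable {ι Ω : Type*}

/-- Changing the coordinate `i` alone changes `f` by at most `c i`. -/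
def HasBoundedDifferences (f : (ι → Ω) → ℝ) (c : ι → ℝ≥0) : Prop :=
  ∀ i x y, (∀ j, j ≠ i → x j = y j) → |f x - f y| ≤ c i

lemma HasBoundedDifferences.abs_sub_le_sum [Fintype ι] {f : (ι → Ω) → ℝ} {c : ι → ℝ≥0}
    (h : HasBoundedDifferences f c) (x y : ι → Ω) : |f x - f y| ≤ ∑ i, (c i : ℝ) := by
  classical
  suffices H : ∀ (s : Finset ι) (x y : ι → Ω), (∀ j, j ∉ s → x j = y j) →
      |f x - f y| ≤ ∑ i ∈ s, (c i : ℝ) from H Finset.univ x y (by simp)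
  intro s
  induction s using Finset.induction_on with
  | empty =>
    intro x y hxy
    simp [funext fun j => hxy j (by simp)]
  | insert a s ha ih =>
    intro x y hxy
    have h1 : |f x - f (Function.update x a (y a))| ≤ c a :=
      h a _ _ fun j hj => by simp [hj]
    have h2 : |f (Function.update x a (y a)) - f y| ≤ ∑ i ∈ s, (c i : ℝ) := by
      refine ih _ _ fun j hj => ?_
      by_cases hja : j = a
      · subst hja; simp
      · simpa [hja] using hxy j (by simp [hja, hj])
    rw [Finset.sum_insert ha]
    calc |f x - f y| ≤ |f x - f (Function.update x a (y a))|
          + |f (Function.update x a (y a)) - f y| := abs_sub_le _ _ _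
      _ ≤ _ := add_le_add h1 h2

lemma HasBoundedDifferences.exists_abs_le [Fintype ι] {f : (ι → Ω) → ℝ} {c : ι → ℝ≥0}
    (h : HasBoundedDifferences f c) : ∃ C, ∀ x, |f x| ≤ C := by
  rcases isEmpty_or_nonempty (ι → Ω) with he | ⟨⟨x₀⟩⟩
  · exact ⟨0, fun x => he.elim x⟩
  · refine ⟨(∑ i, (c i : ℝ)) + |f x₀|, fun x => ?_⟩
    have := h.abs_sub_le_sum x x₀
    have h2 : |f x| ≤ |f x - f x₀| + |f x₀| := by
      simpa using abs_add_le (f x - f x₀) (f x₀)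
    linarith

variable [MeasurableSpace Ω]

/-- The inductive step of McDiarmid's lemma: on a product space, the fluctuation of `F` around its
mean is the sum of that of its average over the second variable and of an inner fluctuation which is
sub-Gaussian uniformly in the first variable. -/
lemma hasSubgaussianMGF_prod {Ω' : Type*} [MeasurableSpace Ω'] {μ : Measure Ω} {ν : Measure Ω'}
    [IsProbabilityMeasure μ] [IsProbabilityMeasure ν] {F : Ω × Ω' → ℝ} (hF : Measurable F)
    {C : ℝ} (hC : ∀ p, |F p| ≤ C) {a b : ℝ≥0}
    (h1 : HasSubgaussianMGF (fun x => (∫ y, F (x, y) ∂ν) - ∫ x', ∫ y, F (x', y) ∂ν ∂μ) a μ)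
    (h2 : ∀ x, HasSubgaussianMGF (fun y => F (x, y) - ∫ y', F (x, y') ∂ν) b ν) :
    HasSubgaussianMGF (fun p => F p - ∫ q, F q ∂(μ.prod ν)) (a + b) (μ.prod ν) := by
  have hFi : Integrable F (μ.prod ν) :=
    Integrable.of_bound hF.aestronglyMeasurable C (ae_of_all _ hC)
  have hint : ∀ t : ℝ, Integrable (fun p => Real.exp (t * (F p - ∫ q, F q ∂(μ.prod ν))))
      (μ.prod ν) := by
    intro t
    refine integrable_exp_mul_of_mem_Icc (a := -C - ∫ q, F q ∂(μ.prod ν))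
      (b := C - ∫ q, F q ∂(μ.prod ν)) (by fun_prop) (ae_of_all _ fun p => ?_)
    have := abs_le.1 (hC p)
    constructor <;> linarith
  refine ⟨hint, fun t => ?_⟩
  set m : ℝ := ∫ q, F q ∂(μ.prod ν) with hm
  have hm' : m = ∫ x', ∫ y, F (x', y) ∂ν ∂μ := integral_prod _ hFi
  rw [← hm'] at h1
  set g : Ω → ℝ := fun x => ∫ y, F (x, y) ∂ν with hg
  -- Fubini: `F (x, y) - m = (F (x, y) - g x) + (g x - m)`
  calc mgf (fun p => F p - m) (μ.prod ν) t
      = ∫ x, ∫ y, Real.exp (t * (F (x, y) - m)) ∂ν ∂μ := integral_prod _ (hint t)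
    _ = ∫ x, Real.exp (t * (g x - m)) * mgf (fun y => F (x, y) - g x) ν t ∂μ := by
        refine integral_congr_ae (ae_of_all _ fun x => ?_)
        simp only [mgf]
        rw [← integral_const_mul]
        refine integral_congr_ae (ae_of_all _ fun y => ?_)
        simp only
        rw [← Real.exp_add]
        ring_nf
    _ ≤ ∫ x, Real.exp (t * (g x - m)) * Real.exp (b * t ^ 2 / 2) ∂μ := by
        refine integral_mono_of_nonneg (ae_of_all _ fun x => ?_)
          ((h1.integrable_exp_mul t).mul_const _) (ae_of_all _ fun x => ?_)
        · exact mul_nonneg (Real.exp_nonneg _) mgf_nonneg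
        · exact mul_le_mul_of_nonneg_left ((h2 x).mgf_le t) (Real.exp_nonneg _)
    _ = mgf (fun x => g x - m) μ t * Real.exp (b * t ^ 2 / 2) := by
        rw [integral_mul_const]; rfl
    _ ≤ Real.exp (a * t ^ 2 / 2) * Real.exp (b * t ^ 2 / 2) :=
        mul_le_mul_of_nonneg_right (h1.mgf_le t) (Real.exp_nonneg _)
    _ = Real.exp ((a + b : ℝ≥0) * t ^ 2 / 2) := by
        rw [← Real.exp_add]; push_cast; ring_nf

/-- A function whose oscillation is at most `c` is sub-Gaussian around its mean. -/
lemma hasSubgaussianMGF_of_abs_sub_le {μ : Measure Ω} [IsProbabilityMeasure μ] {g : Ω → ℝ}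
    (hg : Measurable g) {c : ℝ≥0} (h : ∀ x y, |g x - g y| ≤ c) :
    HasSubgaussianMGF (fun x => g x - ∫ x', g x' ∂μ) ((c / 2) ^ 2) μ := by
  -- the values of `g` lie in the interval of length `c` that starts at its infimum
  have : Nonempty Ω := nonempty_of_isProbabilityMeasure μ
  have hb : BddBelow (Set.range g) := by
    obtain ⟨x₀⟩ := this
    refine ⟨g x₀ - c, ?_⟩
    rintro _ ⟨x, rfl⟩
    have := abs_le.1 (h x x₀)
    linarith
  have key := hasSubgaussianMGF_of_mem_Icc (μ := μ) (X := g) (a := ⨅ x, g x)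
    (b := (⨅ x, g x) + c) hg.aemeasurable (ae_of_all _ fun x => ⟨ciInf_le hb x, ?_⟩)
  · simpa using key
  · have : g x - c ≤ ⨅ y, g y := le_ciInf fun y => by
      have := abs_le.1 (h x y)
      linarith
    linarith

lemma HasBoundedDifferences.hasSubgaussianMGF_fin {N : ℕ} {μ : Fin N → Measure Ω}
    [∀ i, IsProbabilityMeasure (μ i)] {f : (Fin N → Ω) → ℝ} (hf : Measurable f) {c : Fin N → ℝ≥0}
    (h : HasBoundedDifferences f c) :
    HasSubgaussianMGF (fun x => f x - ∫ z, f z ∂(Measure.pi μ)) (∑ i, (c i / 2) ^ 2)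
      (Measure.pi μ) := by
  induction N with
  | zero =>
    have : (fun x => f x - ∫ z, f z ∂(Measure.pi μ)) = fun _ => 0 := by
      funext x
      have : f = fun _ => f x := funext fun z => congrArg f (Subsingleton.elim _ _)
      rw [this]; simp
    rw [this]
    simp
  | succ N ih =>
    obtain ⟨C, hC⟩ := h.exists_abs_le
    set e := MeasurableEquiv.piFinSuccAbove (fun _ : Fin (N + 1) => Ω) 0 with he
    have hp : MeasurePreserving e (Measure.pi μ)
        ((μ 0).prod (Measure.pi fun j => μ (Fin.succAbove 0 j))) :=
      measurePreserving_piFinSuccAbove μ 0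
    have hes : ∀ p, e.symm p = Fin.cons p.1 p.2 := fun p => by
      simp only [he, MeasurableEquiv.piFinSuccAbove]
      simp [Fin.consEquiv]
    set F : Ω × (Fin N → Ω) → ℝ := fun p => f (e.symm p) with hF
    have hFm : Measurable F := hf.comp e.symm.measurable
    have hFC : ∀ p, |F p| ≤ C := fun p => hC _
    have hFi : ∀ x, Integrable (fun y => F (x, y)) (Measure.pi fun j => μ (Fin.succAbove 0 j)) :=
      fun x => Integrable.of_bound
        (hFm.comp measurable_prodMk_left).aestronglyMeasurable C (ae_of_all _ fun y => hFC (x, y))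
    have hprod := hasSubgaussianMGF_prod (μ := μ 0)
      (ν := Measure.pi fun j => μ (Fin.succAbove 0 j)) hFm hFC (a := (c 0 / 2) ^ 2)
      (b := ∑ i : Fin N, (c i.succ / 2) ^ 2) ?_ ?_
    · rw [← hp.map_eq] at hprod
      have := HasSubgaussianMGF.of_map hp.measurable.aemeasurable hprod
      rw [integral_map_equiv] at this
      rw [Fin.sum_univ_succ]
      simpa [hF, Function.comp_def] using this
    · refine hasSubgaussianMGF_of_abs_sub_le
        (hFm.stronglyMeasurable.integral_prod_right'.measurable) fun x x' => ?_
      rw [← integral_sub (hFi x) (hFi x')]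
      have := norm_integral_le_of_norm_le_const (μ := Measure.pi fun j => μ (Fin.succAbove 0 j))
        (f := fun y => F (x, y) - F (x', y)) (C := c 0) (ae_of_all _ fun y => ?_)
      · simpa using this
      · refine h 0 _ _ fun j hj => ?_
        obtain ⟨i, rfl⟩ := Fin.exists_succ_eq_of_ne_zero hj
        simp [hes]
    · intro x
      refine ih (f := fun y => F (x, y)) (hFm.comp measurable_prodMk_left)
        fun i y y' hy => h i.succ _ _ fun j hj => ?_
      simp only [hes]
      refine Fin.cases (fun _ => by simp) (fun j hj => ?_) j hj
      simpa using hy j (by simpa using hj)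

/-- **McDiarmid's lemma**: a function of independent variables with bounded differences `c` is
sub-Gaussian around its mean, with variance proxy `∑ (c i / 2) ^ 2`. -/
theorem HasBoundedDifferences.hasSubgaussianMGF [Fintype ι] {μ : ι → Measure Ω}
    [∀ i, IsProbabilityMeasure (μ i)] {f : (ι → Ω) → ℝ} (hf : Measurable f) {c : ι → ℝ≥0}
    (h : HasBoundedDifferences f c) :
    HasSubgaussianMGF (fun x => f x - ∫ z, f z ∂(Measure.pi μ)) (∑ i, (c i / 2) ^ 2)
      (Measure.pi μ) := by
  set σ := (Fintype.equivFin ι).symm with hσ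
  set e := MeasurableEquiv.piCongrLeft (fun _ : ι => Ω) σ with he
  have hp : MeasurePreserving e (Measure.pi fun i => μ (σ i)) (Measure.pi μ) :=
    measurePreserving_piCongrLeft μ σ
  have hes : ∀ x i, e x (σ i) = x i := fun x i =>
    Equiv.piCongrLeft_apply_apply (fun _ : ι => Ω) σ x i
  have key := HasBoundedDifferences.hasSubgaussianMGF_fin (μ := fun i => μ (σ i))
    (f := fun x => f (e x)) (c := fun i => c (σ i)) (hf.comp e.measurable) fun i x y hxy => by
      refine h (σ i) _ _ fun j hj => ?_
      obtain ⟨j, rfl⟩ := σ.surjective j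
      rw [hes, hes]
      exact hxy j fun hji => hj (by rw [hji])
  rw [Equiv.sum_comp σ fun i => (c i / 2) ^ 2] at key
  rw [hp.integral_comp e.measurableEmbedding f, ← hp.symm.map_eq] at key
  simpa [Function.comp_def] using HasSubgaussianMGF.of_map hp.symm.measurable.aemeasurable key

end BoundedDifferences

/-! ### Bounded kernels -/

section Kernel

variable {k : ℝ → ℝ → ℝ}

lemma IsBoundedKernel.symm (hk : IsBoundedKernel k) (x y : ℝ) : k x y = k y x := by
  simpa using hk.posSemidef.isHermitian.apply y x

lemma IsBoundedKernel.le_kernelMax (hk : IsBoundedKernel k) (x y : ℝ) : k x y ≤ kernelMax k :=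
  le_ciSup (f := fun p : ℝ × ℝ => k p.1 p.2) hk.bddAbove (x, y)

/-- A positive semidefinite kernel is bounded below by `-K₀`, since
`k x x + 2 k x y + k y y ≥ 0`. -/
lemma IsBoundedKernel.abs_le_kernelMax (hk : IsBoundedKernel k) (x y : ℝ) :
    |k x y| ≤ kernelMax k := by
  have h := (hk.posSemidef.submatrix ![x, y]).dotProduct_mulVec_nonneg ![1, 1]
  simp [Matrix.mulVec, dotProduct, Fin.sum_univ_two] at h
  have h1 := hk.le_kernelMax x x
  have h2 := hk.le_kernelMax y y
  have h3 := hk.symm x y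
  exact abs_le.2 ⟨by linarith, hk.le_kernelMax x y⟩

lemma IsBoundedKernel.kernelMax_nonneg (hk : IsBoundedKernel k) : 0 ≤ kernelMax k :=
  (abs_nonneg _).trans (hk.abs_le_kernelMax 0 0)

lemma IsBoundedKernel.abs_sub_le (hk : IsBoundedKernel k) (x y x' y' : ℝ) :
    |k x y - k x' y'| ≤ 2 * kernelMax k := by
  have h1 := abs_le.1 (hk.abs_le_kernelMax x y)
  have h2 := abs_le.1 (hk.abs_le_kernelMax x' y')
  exact abs_le.2 ⟨by linarith, by linarith⟩

lemma IsBoundedKernel.measurable_comp (hk : IsBoundedKernel k) {Ω : Type*} [MeasurableSpace Ω]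
    {f g : Ω → ℝ} (hf : Measurable f) (hg : Measurable g) : Measurable fun ω => k (f ω) (g ω) :=
  hk.measurable.comp (hf.prodMk hg)

lemma IsBoundedKernel.integrable_comp (hk : IsBoundedKernel k) {Ω : Type*} [MeasurableSpace Ω]
    {μ : Measure Ω} [IsFiniteMeasure μ] {f g : Ω → ℝ} (hf : Measurable f) (hg : Measurable g) :
    Integrable (fun ω => k (f ω) (g ω)) μ :=
  Integrable.of_bound (hk.measurable_comp hf hg).aestronglyMeasurable (kernelMax k)
    (ae_of_all _ fun _ => hk.abs_le_kernelMax _ _)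

/-- The mean `E k(X, Y)` of the kernel for independent `X ∼ μ` and `Y ∼ ν`. -/
noncomputable def kernelMean (k : ℝ → ℝ → ℝ) (μ ν : Measure ℝ) : ℝ :=
  ∫ p, k p.1 p.2 ∂(μ.prod ν)

lemma IsBoundedKernel.kernelMean_symm (hk : IsBoundedKernel k) (μ ν : Measure ℝ)
    [IsProbabilityMeasure μ] [IsProbabilityMeasure ν] :
    kernelMean k μ ν = kernelMean k ν μ := by
  unfold kernelMean
  rw [← integral_prod_swap]
  simp [hk.symm]

lemma mmdSq_eq_kernelMean (f₁ f₂ : ℝ → ℝ) :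
    mmdSq k f₁ f₂ = kernelMean k (law f₁) (law f₁) - 2 * kernelMean k (law f₁) (law f₂)
      + kernelMean k (law f₂) (law f₂) := rfl

lemma IsPDF.isProbabilityMeasure_law {f : ℝ → ℝ} (hf : IsPDF f) :
    IsProbabilityMeasure (law f) :=
  ⟨by simpa [law] using hf.lintegral_eq_one⟩

/-- Two different coordinates of a product measure are independent. -/
lemma IsBoundedKernel.integral_pi_eval (hk : IsBoundedKernel k) {τ : Type*} [Fintype τ]
    (ν : τ → Measure ℝ) [∀ a, IsProbabilityMeasure (ν a)] {a b : τ} (hab : a ≠ b) :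
    ∫ z, k (z a) (z b) ∂(Measure.pi ν) = kernelMean k (ν a) (ν b) := by
  have hind : IndepFun (fun z : τ → ℝ => z a) (fun z : τ → ℝ => z b) (Measure.pi ν) :=
    (iIndepFun_pi (μ := ν) (X := fun _ x => x) fun _ => aemeasurable_id).indepFun hab
  have hmap := (indepFun_iff_map_prod_eq_prod_map_map
    (measurable_pi_apply a).aemeasurable (measurable_pi_apply b).aemeasurable).1 hind
  have hev : ∀ c, (Measure.pi ν).map (fun z : τ → ℝ => z c) = ν c := fun c =>
    (measurePreserving_eval ν c).map_eq
  rw [hev, hev] at hmap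
  rw [kernelMean, ← hmap, integral_map (by fun_prop)]
  exact hk.measurable.aestronglyMeasurable

end Kernel

/-! ### Fluctuations and mean of the sample discrepancy -/

section Sample

variable {k : ℝ → ℝ → ℝ} {ι κ : Type} [Fintype ι] [Fintype κ]

lemma IsBoundedKernel.abs_cross_sub_le (hk : IsBoundedKernel k) (a : ι) (x x' : ι → ℝ)
    (y : κ → ℝ) (h : ∀ i, i ≠ a → x i = x' i) :
    |(∑ i, ∑ j, k (x i) (y j)) - ∑ i, ∑ j, k (x' i) (y j)|
      ≤ 2 * (Fintype.card κ : ℝ) * kernelMax k := by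
  rw [← Finset.sum_sub_distrib, Finset.sum_eq_single a
    (fun i _ hi => by simp [h i hi]) (by simp), ← Finset.sum_sub_distrib]
  refine (Finset.abs_sum_le_sum_abs _ _).trans
    ((Finset.sum_le_sum fun j _ => hk.abs_sub_le _ _ _ _).trans_eq ?_)
  simp
  ring

/-- The constants of the bounded differences property of the sample discrepancy. -/
noncomputable def mmdSqOscillation (k : ℝ → ℝ → ℝ) (ι κ : Type) [Fintype ι] [Fintype κ] :
    ι ⊕ κ → ℝ≥0 :=
  Sum.elim (fun _ => (8 * kernelMax k / Fintype.card ι).toNNReal)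
    (fun _ => (8 * kernelMax k / Fintype.card κ).toNNReal)

lemma IsBoundedKernel.sum_mmdSqOscillation (hk : IsBoundedKernel k) [Nonempty ι] [Nonempty κ] :
    ((∑ a, (mmdSqOscillation k ι κ a / 2) ^ 2 : ℝ≥0) : ℝ)
      = 16 * kernelMax k ^ 2 * (1 / Fintype.card ι + 1 / Fintype.card κ) := by
  have hK := hk.kernelMax_nonneg
  have hn : (0 : ℝ) < Fintype.card ι := by exact_mod_cast Fintype.card_pos
  have hm : (0 : ℝ) < Fintype.card κ := by exact_mod_cast Fintype.card_pos
  simp only [mmdSqOscillation, Fintype.sum_sum_type, Sum.elim_inl, Sum.elim_inr, Finset.sum_const,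
    Finset.card_univ, nsmul_eq_mul]
  push_cast
  rw [Real.coe_toNNReal _ (by positivity), Real.coe_toNNReal _ (by positivity)]
  field_simp
  ring

variable [DecidableEq ι] [DecidableEq κ]

lemma sum_sum_ite_ne_const (c : ℝ) :
    ∑ i : ι, ∑ j : ι, (if i ≠ j then c else 0)
      = (Fintype.card ι : ℝ) * ((Fintype.card ι : ℝ) - 1) * c := by
  have : ∀ i : ι, ∑ j : ι, (if i ≠ j then c else 0) = ((Fintype.card ι : ℝ) - 1) * c := by
    intro i
    have : ∀ j : ι, (if i ≠ j then c else 0) = c - if i = j then c else 0 := by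
      intro j; split_ifs <;> simp_all
    simp only [this, Finset.sum_sub_distrib, Finset.sum_ite_eq]
    simp
    ring
  rw [Finset.sum_congr rfl fun i _ => this i]
  simp
  ring

/-- Changing one entry of a sample changes `2 (n - 1)` of the off-diagonal terms `k (xᵢ, xⱼ)`. -/
lemma IsBoundedKernel.abs_offDiag_sub_le (hk : IsBoundedKernel k) (a : ι) (x y : ι → ℝ)
    (h : ∀ i, i ≠ a → x i = y i) :
    |(∑ i, ∑ j, if i ≠ j then k (x i) (x j) else 0)
      - ∑ i, ∑ j, if i ≠ j then k (y i) (y j) else 0|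
      ≤ 4 * ((Fintype.card ι : ℝ) - 1) * kernelMax k := by
  have hK := hk.kernelMax_nonneg
  have hterm : ∀ i j, |(if i ≠ j then k (x i) (x j) else 0) - if i ≠ j then k (y i) (y j) else 0|
      ≤ (if a = i then (2 * kernelMax k - if a = j then 2 * kernelMax k else 0) else 0)
        + (if a = j then (2 * kernelMax k - if a = i then 2 * kernelMax k else 0) else 0) := by
    intro i j
    by_cases hij : i = j
    · subst hij; simp; split_ifs <;> simp
    · by_cases hi : a = i
      · subst hi
        have := hk.abs_sub_le (x a) (x j) (y a) (y j)
        simpa [hij] using this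
      · by_cases hj : a = j
        · subst hj
          have := hk.abs_sub_le (x i) (x a) (y i) (y a)
          simpa [hij, hi] using this
        · simp [hi, hj, h i (Ne.symm hi), h j (Ne.symm hj)]
  have hsum : ∑ i : ι, ∑ j : ι,
      ((if a = i then (2 * kernelMax k - if a = j then 2 * kernelMax k else 0) else 0)
        + (if a = j then (2 * kernelMax k - if a = i then 2 * kernelMax k else 0) else 0))
      = 4 * ((Fintype.card ι : ℝ) - 1) * kernelMax k := by
    simp only [Finset.sum_add_distrib, Finset.sum_ite_eq, Finset.mem_univ, if_true,
      Finset.sum_sub_distrib]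
    rw [Finset.sum_comm]
    simp
    ring
  rw [← hsum, ← Finset.sum_sub_distrib]
  refine (Finset.abs_sum_le_sum_abs _ _).trans (Finset.sum_le_sum fun i _ => ?_)
  rw [← Finset.sum_sub_distrib]
  exact (Finset.abs_sum_le_sum_abs _ _).trans (Finset.sum_le_sum fun j _ => hterm i j)

lemma IsBoundedKernel.sampleMMDSq_swap (hk : IsBoundedKernel k) (x : ι → ℝ) (y : κ → ℝ) :
    sampleMMDSq k x y = sampleMMDSq k y x := by
  have : ∑ i, ∑ j, k (x i) (y j) = ∑ j, ∑ i, k (y j) (x i) := by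
    rw [Finset.sum_comm]; simp only [hk.symm]
  unfold sampleMMDSq
  rw [this]
  ring

lemma IsBoundedKernel.abs_sampleMMDSq_sub_le (hk : IsBoundedKernel k)
    (hι : 2 ≤ Fintype.card ι) (hκ : 2 ≤ Fintype.card κ) (a : ι) (x x' : ι → ℝ)
    (y : κ → ℝ) (h : ∀ i, i ≠ a → x i = x' i) :
    |sampleMMDSq k x y - sampleMMDSq k x' y| ≤ 8 * kernelMax k / Fintype.card ι := by
  have h1 := hk.abs_offDiag_sub_le a x x' h
  have h2 := hk.abs_cross_sub_le a x x' y h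
  have hι' : (2 : ℝ) ≤ Fintype.card ι := by exact_mod_cast hι
  have hκ' : (2 : ℝ) ≤ Fintype.card κ := by exact_mod_cast hκ
  unfold sampleMMDSq
  set n : ℝ := (Fintype.card ι : ℝ)
  set m : ℝ := (Fintype.card κ : ℝ)
  set u := ∑ i, ∑ j, if i ≠ j then k (x i) (x j) else 0
  set u' := ∑ i, ∑ j, if i ≠ j then k (x' i) (x' j) else 0
  set w := ∑ i, ∑ j, k (x i) (y j)
  set w' := ∑ i, ∑ j, k (x' i) (y j)
  have hn : 0 < n * (n - 1) := mul_pos (by linarith) (by linarith)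
  have hm : 0 < n * m := mul_pos (by linarith) (by linarith)
  have e1 : |1 / (n * (n - 1)) * (u - u')| ≤ 4 * kernelMax k / n := by
    rw [abs_mul, abs_of_pos (by positivity)]
    calc _ ≤ 1 / (n * (n - 1)) * (4 * (n - 1) * kernelMax k) :=
          mul_le_mul_of_nonneg_left h1 (by positivity)
      _ = _ := by
          have : n - 1 ≠ 0 := by linarith
          field_simp
  have e2 : |2 / (n * m) * (w - w')| ≤ 4 * kernelMax k / n := by
    rw [abs_mul, abs_of_pos (by positivity)]
    calc _ ≤ 2 / (n * m) * (2 * m * kernelMax k) :=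
          mul_le_mul_of_nonneg_left h2 (by positivity)
      _ = _ := by
          field_simp
          ring
  rw [abs_le] at *
  have : 8 * kernelMax k / n = 4 * kernelMax k / n + 4 * kernelMax k / n := by ring
  constructor <;> linarith [e1.1, e1.2, e2.1, e2.2]

/-- The sample discrepancy as a function of the joint sample. -/
noncomputable def jointMMDSq (k : ℝ → ℝ → ℝ) (z : ι ⊕ κ → ℝ) : ℝ :=
  sampleMMDSq k (fun i => z (Sum.inl i)) (fun j => z (Sum.inr j))

lemma IsBoundedKernel.measurable_jointMMDSq (hk : IsBoundedKernel k) :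
    Measurable (jointMMDSq k : (ι ⊕ κ → ℝ) → ℝ) := by
  have h : ∀ a b : ι ⊕ κ, Measurable fun z : ι ⊕ κ → ℝ => k (z a) (z b) := fun a b =>
    hk.measurable_comp (measurable_pi_apply a) (measurable_pi_apply b)
  have h1 : ∀ (i j : ι), Measurable fun z : ι ⊕ κ → ℝ =>
      if i ≠ j then k (z (Sum.inl i)) (z (Sum.inl j)) else 0 := fun i j => by
    split_ifs
    exacts [h _ _, measurable_const]
  have h2 : ∀ (i j : κ), Measurable fun z : ι ⊕ κ → ℝ =>
      if i ≠ j then k (z (Sum.inr i)) (z (Sum.inr j)) else 0 := fun i j => by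
    split_ifs
    exacts [h _ _, measurable_const]
  unfold jointMMDSq sampleMMDSq
  exact ((measurable_const.mul (Finset.measurable_fun_sum _ fun i _ =>
    Finset.measurable_fun_sum _ fun j _ => h1 i j)).add (measurable_const.mul
      (Finset.measurable_fun_sum _ fun i _ => Finset.measurable_fun_sum _ fun j _ => h2 i j))).sub
    (measurable_const.mul (Finset.measurable_fun_sum _ fun i _ =>
      Finset.measurable_fun_sum _ fun j _ => h _ _))

lemma IsBoundedKernel.hasBoundedDifferences_jointMMDSq (hk : IsBoundedKernel k)
    (hι : 2 ≤ Fintype.card ι) (hκ : 2 ≤ Fintype.card κ) :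
    HasBoundedDifferences (jointMMDSq k) (mmdSqOscillation k ι κ) := by
  have hK := hk.kernelMax_nonneg
  rintro (a | a) x y hxy
  · have hy : (fun j => x (Sum.inr j)) = fun j => y (Sum.inr j) :=
      funext fun j => hxy _ (by simp)
    unfold jointMMDSq mmdSqOscillation
    rw [hy]
    refine (hk.abs_sampleMMDSq_sub_le hι hκ a _ _ _ fun i hi => hxy _ (by simpa using hi)).trans ?_
    simp
  · have hy : (fun j => x (Sum.inl j)) = fun j => y (Sum.inl j) :=
      funext fun j => hxy _ (by simp)
    unfold jointMMDSq mmdSqOscillation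
    rw [hy, hk.sampleMMDSq_swap, hk.sampleMMDSq_swap _ fun j => y (Sum.inr j)]
    refine (hk.abs_sampleMMDSq_sub_le hκ hι a _ _ _ fun i hi => hxy _ (by simpa using hi)).trans ?_
    simp

lemma IsBoundedKernel.integral_jointMMDSq (hk : IsBoundedKernel k) (hι : 2 ≤ Fintype.card ι)
    (hκ : 1 ≤ Fintype.card κ) (ν : ι ⊕ κ → Measure ℝ) [∀ a, IsProbabilityMeasure (ν a)]
    (μ : Measure ℝ) (hμ : ∀ i, ν (Sum.inl i) = μ) :
    ∫ z, jointMMDSq k z ∂(Measure.pi ν)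
      = kernelMean k μ μ
        + 1 / ((Fintype.card κ : ℝ) * ((Fintype.card κ : ℝ) - 1)) *
          (∑ i, ∑ j, if i ≠ j then kernelMean k (ν (Sum.inr i)) (ν (Sum.inr j)) else 0)
        - 2 / (Fintype.card κ : ℝ) * ∑ j, kernelMean k μ (ν (Sum.inr j)) := by
  have hι' : (2 : ℝ) ≤ Fintype.card ι := by exact_mod_cast hι
  have hκ' : (1 : ℝ) ≤ Fintype.card κ := by exact_mod_cast hκ
  have hi : ∀ a b : ι ⊕ κ, Integrable (fun z => k (z a) (z b)) (Measure.pi ν) := fun a b =>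
    hk.integrable_comp (measurable_pi_apply a) (measurable_pi_apply b)
  have hii : ∀ (p : Prop) [Decidable p] (a b : ι ⊕ κ),
      Integrable (fun z => if p then k (z a) (z b) else 0) (Measure.pi ν) := fun p _ a b => by
    split_ifs
    exacts [hi a b, integrable_const _]
  have hval : ∀ (p : Prop) [Decidable p] (a b : ι ⊕ κ), (p → a ≠ b) →
      ∫ z, (if p then k (z a) (z b) else 0) ∂(Measure.pi ν)
        = if p then kernelMean k (ν a) (ν b) else 0 := fun p _ a b hab => by
    split_ifs with hp
    exacts [hk.integral_pi_eval ν (hab hp), by simp]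
  have s1 : ∫ z, (∑ i : ι, ∑ j : ι, if i ≠ j then k (z (Sum.inl i)) (z (Sum.inl j)) else 0)
      ∂(Measure.pi ν) = (Fintype.card ι : ℝ) * ((Fintype.card ι : ℝ) - 1) * kernelMean k μ μ := by
    rw [integral_finsetSum _ fun i _ => integrable_finsetSum _ fun j _ => hii _ _ _]
    rw [← sum_sum_ite_ne_const]
    refine Finset.sum_congr rfl fun i _ => ?_
    rw [integral_finsetSum _ fun j _ => hii _ _ _]
    refine Finset.sum_congr rfl fun j _ => ?_
    rw [hval _ _ _ (by simp), hμ, hμ]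
  have s2 : ∫ z, (∑ i : κ, ∑ j : κ, if i ≠ j then k (z (Sum.inr i)) (z (Sum.inr j)) else 0)
      ∂(Measure.pi ν)
      = ∑ i, ∑ j, if i ≠ j then kernelMean k (ν (Sum.inr i)) (ν (Sum.inr j)) else 0 := by
    rw [integral_finsetSum _ fun i _ => integrable_finsetSum _ fun j _ => hii _ _ _]
    refine Finset.sum_congr rfl fun i _ => ?_
    rw [integral_finsetSum _ fun j _ => hii _ _ _]
    refine Finset.sum_congr rfl fun j _ => ?_
    rw [hval _ _ _ (by simp)]
  have s3 : ∫ z, (∑ i : ι, ∑ j : κ, k (z (Sum.inl i)) (z (Sum.inr j))) ∂(Measure.pi ν)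
      = (Fintype.card ι : ℝ) * ∑ j, kernelMean k μ (ν (Sum.inr j)) := by
    rw [integral_finsetSum _ fun i _ => integrable_finsetSum _ fun j _ => hi _ _]
    have : ∀ i : ι, ∫ z, (∑ j : κ, k (z (Sum.inl i)) (z (Sum.inr j))) ∂(Measure.pi ν)
        = ∑ j, kernelMean k μ (ν (Sum.inr j)) := fun i => by
      rw [integral_finsetSum _ fun j _ => hi _ _]
      refine Finset.sum_congr rfl fun j _ => ?_
      rw [hk.integral_pi_eval ν (by simp), hμ]
    simp [this]
  unfold jointMMDSq sampleMMDSq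
  rw [integral_sub, integral_add, integral_const_mul, integral_const_mul, integral_const_mul,
    s1, s2, s3]
  · have : (Fintype.card ι : ℝ) - 1 ≠ 0 := by linarith
    have : (Fintype.card ι : ℝ) ≠ 0 := by linarith
    have : (Fintype.card κ : ℝ) ≠ 0 := by linarith
    congr 1
    · congr 1
      field_simp
    · field_simp
  · exact (integrable_finsetSum _ fun i _ => integrable_finsetSum _ fun j _ =>
      hii _ _ _).const_mul _
  · exact (integrable_finsetSum _ fun i _ => integrable_finsetSum _ fun j _ =>
      hii _ _ _).const_mul _
  · exact ((integrable_finsetSum _ fun i _ => integrable_finsetSum _ fun j _ =>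
      hii _ _ _).const_mul _).add ((integrable_finsetSum _ fun i _ =>
        integrable_finsetSum _ fun j _ => hii _ _ _).const_mul _)
  · exact (integrable_finsetSum _ fun i _ => integrable_finsetSum _ fun j _ =>
      hi _ _).const_mul _

end Sample

/-! ### Mean discrepancy from a mixture -/

section Mixture

variable {k : ℝ → ℝ → ℝ} {ι κ : Type} [Fintype ι] [Fintype κ] [DecidableEq ι] [DecidableEq κ]

lemma sum_sum_ite_ne (w : κ → κ → ℝ) :
    ∑ i, ∑ j, (if i ≠ j then w i j else 0) = (∑ i, ∑ j, w i j) - ∑ i, w i i := by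
  have : ∀ i j : κ, (if i ≠ j then w i j else 0) = w i j - if i = j then w i j else 0 := by
    intro i j; split_ifs <;> simp_all
  simp [this, Finset.sum_sub_distrib]

/-- If both samples are i.i.d. from the same law, the sample discrepancy is centred. -/
lemma IsBoundedKernel.integral_jointMMDSq_of_eq (hk : IsBoundedKernel k)
    (hι : 2 ≤ Fintype.card ι) (hκ : 2 ≤ Fintype.card κ) (ν : ι ⊕ κ → Measure ℝ)
    [∀ a, IsProbabilityMeasure (ν a)] (μ : Measure ℝ) (hμ : ∀ a, ν a = μ) :
    ∫ z, jointMMDSq k z ∂(Measure.pi ν) = 0 := by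
  have hκ' : (2 : ℝ) ≤ Fintype.card κ := by exact_mod_cast hκ
  rw [hk.integral_jointMMDSq hι (by omega) ν μ fun i => hμ _]
  simp only [hμ, sum_sum_ite_ne_const, Finset.sum_const, Finset.card_univ, nsmul_eq_mul]
  have : (Fintype.card κ : ℝ) - 1 ≠ 0 := by linarith
  field_simp
  ring

/-- The mean of the sample discrepancy when the first sample is i.i.d. from `μ` and `R` of the
entries of the second sample come from `μ` and the others from `ν₀`.  Up to a term of order
`1 / card κ`, it is the squared distance `(1 - R / card κ) ^ 2 * d` between `μ` and the mixture. -/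
lemma IsBoundedKernel.integral_jointMMDSq_mixture (hk : IsBoundedKernel k)
    (hι : 2 ≤ Fintype.card ι) (hκ : 2 ≤ Fintype.card κ) (ν : ι ⊕ κ → Measure ℝ)
    [∀ a, IsProbabilityMeasure (ν a)] (μ ν₀ : Measure ℝ) [IsProbabilityMeasure μ]
    [IsProbabilityMeasure ν₀] (S : κ → Prop) [DecidablePred S] (hμ : ∀ i, ν (Sum.inl i) = μ)
    (hν : ∀ j, ν (Sum.inr j) = if S j then μ else ν₀) {R : ℕ}
    (hR : (Finset.univ.filter S).card = R) :
    ∫ z, jointMMDSq k z ∂(Measure.pi ν)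
      = (kernelMean k ν₀ ν₀ - 2 * kernelMean k ν₀ μ + kernelMean k μ μ)
        * (1 - 2 * (R / Fintype.card κ)
          + R * (R - 1) / (Fintype.card κ * ((Fintype.card κ : ℝ) - 1))) := by
  have hκ' : (2 : ℝ) ≤ Fintype.card κ := by exact_mod_cast hκ
  rw [hk.integral_jointMMDSq hι (by omega) ν μ hμ, sum_sum_ite_ne]
  set aa := kernelMean k μ μ
  set na := kernelMean k ν₀ μ with hna
  set nn := kernelMean k ν₀ ν₀
  have han : kernelMean k μ ν₀ = na := hk.kernelMean_symm _ _
  set χ : κ → ℝ := fun j => if S j then 1 else 0 with hχ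
  have hsum : ∑ j, χ j = R := by simp [hχ, hR]
  have hsq : ∀ j, χ j * χ j = χ j := fun j => by simp [hχ]
  have h1 : ∀ j, kernelMean k μ (ν (Sum.inr j)) = na + χ j * (aa - na) := fun j => by
    rw [hν]; by_cases h : S j <;> simp [hχ, h, han, aa]
  have h2 : ∀ i j, kernelMean k (ν (Sum.inr i)) (ν (Sum.inr j))
      = nn + (χ i + χ j) * (na - nn) + χ i * χ j * (nn - 2 * na + aa) := fun i j => by
    rw [hν, hν]
    by_cases h : S i <;> by_cases h' : S j <;> simp [hχ, h, h', han, aa, nn, hna] <;> ring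
  have s1 : ∑ j, kernelMean k μ (ν (Sum.inr j)) = Fintype.card κ * na + R * (aa - na) := by
    simp only [h1, Finset.sum_add_distrib, ← Finset.sum_mul, hsum]
    simp
  have s2 : ∑ i, kernelMean k (ν (Sum.inr i)) (ν (Sum.inr i))
      = Fintype.card κ * nn + 2 * R * (na - nn) + R * (nn - 2 * na + aa) := by
    simp only [h2, Finset.sum_add_distrib, ← Finset.sum_mul, hsum, hsq]
    simp only [Finset.sum_const, Finset.card_univ, nsmul_eq_mul]
    ring
  have s3 : ∑ i, ∑ j, kernelMean k (ν (Sum.inr i)) (ν (Sum.inr j))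
      = (Fintype.card κ : ℝ) ^ 2 * nn + 2 * Fintype.card κ * R * (na - nn)
        + R ^ 2 * (nn - 2 * na + aa) := by
    simp only [h2, Finset.sum_add_distrib, ← Finset.sum_mul, ← Finset.mul_sum, hsum]
    simp only [Finset.sum_const, Finset.card_univ, nsmul_eq_mul, hsum, ← Finset.mul_sum]
    ring
  rw [s1, s2, s3]
  have : (Fintype.card κ : ℝ) - 1 ≠ 0 := by linarith
  field_simp
  ring

end Mixture

/-! ### Large deviations of the pooled scores -/

section Data

variable {fN fA : ℝ → ℝ} {M n : ℕ}

lemma isProbabilityMeasure_dataLaw (hfN : IsPDF fN) (hfA : IsPDF fA) (B : Finset (Fin M)) :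
    IsProbabilityMeasure (dataLaw fN fA n B) := by
  have := hfN.isProbabilityMeasure_law
  have := hfA.isProbabilityMeasure_law
  have : ∀ i : Fin M, IsProbabilityMeasure (if i ∈ B then law fA else law fN) := fun i => by
    split_ifs <;> assumption
  unfold dataLaw
  infer_instance

/-- Distinct entries of the data are independent. -/
lemma dataLaw_map_entries (hfN : IsPDF fN) (hfA : IsPDF fA) (B : Finset (Fin M)) {τ : Type*}
    [Fintype τ] (e : τ → Fin M × Fin n) (he : e.Injective) :
    (dataLaw fN fA n B).map (fun y a => y (e a).1 (e a).2)
      = Measure.pi fun a => if (e a).1 ∈ B then law fA else law fN := by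
  have := hfN.isProbabilityMeasure_law
  have := hfA.isProbabilityMeasure_law
  set ν : Fin M → Measure ℝ := fun i => if i ∈ B then law fA else law fN with hν
  have hν' : ∀ i : Fin M, IsProbabilityMeasure (ν i) := fun i => by
    simp only [hν]; split_ifs <;> assumption
  have hmeas : ∀ p : Fin M × Fin n,
      Measurable fun y : Fin M → Fin n → ℝ => y p.1 p.2 := fun p => by fun_prop
  have hprob := isProbabilityMeasure_dataLaw (n := n) hfN hfA B
  have hind : iIndepFun (fun (p : Fin M × Fin n) (y : Fin M → Fin n → ℝ) => y p.1 p.2)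
      (dataLaw fN fA n B) := by
    have := iIndepFun_uncurry_infinitePi' (X := fun (_ : Fin M) (_ : Fin n) (x : ℝ) => x)
      (fun (i : Fin M) (_ : Fin n) => ν i) (fun _ _ => measurable_id)
    simp only [Measure.infinitePi_eq_pi] at this
    exact this
  have hmarg : ∀ p : Fin M × Fin n,
      (dataLaw fN fA n B).map (fun y => y p.1 p.2) = ν p.1 := fun p => by
    have h1 : (dataLaw fN fA n B).map (fun y => y p.1) = Measure.pi fun _ : Fin n => ν p.1 :=
      (measurePreserving_eval (fun i => Measure.pi fun _ : Fin n => ν i) p.1).map_eq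
    have h2 : (Measure.pi fun _ : Fin n => ν p.1).map (fun x => x p.2) = ν p.1 :=
      (measurePreserving_eval (fun _ : Fin n => ν p.1) p.2).map_eq
    rw [← h1, Measure.map_map (measurable_pi_apply _) (measurable_pi_apply _)] at h2
    exact h2
  rw [(iIndepFun_iff_map_fun_eq_pi_map fun a => (hmeas (e a)).aemeasurable).1 (hind.precomp he)]
  simp only [hmarg, hν]

/-- The discrepancy between the `j`-th sequence and the pooled sequences outside `D ∪ {j}`. -/
noncomputable def pooledMMDSq (k : ℝ → ℝ → ℝ) (D : Finset (Fin M)) (j : Fin M)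
    (y : Fin M → Fin n → ℝ) : ℝ :=
  sampleMMDSq k (y j) (fun p : {i : Fin M // i ∉ D ∧ i ≠ j} × Fin n => y p.1.1 p.2)

/-- The positions in the data of the entries of the `j`-th sequence and of the pooled sample. -/
def pooledEntry (D : Finset (Fin M)) (j : Fin M) :
    Fin n ⊕ ({i : Fin M // i ∉ D ∧ i ≠ j} × Fin n) → Fin M × Fin n :=
  Sum.elim (fun l => (j, l)) (fun p => (p.1.1, p.2))

lemma pooledEntry_injective (D : Finset (Fin M)) (j : Fin M) :
    (pooledEntry (n := n) D j).Injective := by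
  rintro (a | ⟨⟨i, hi⟩, a⟩) (b | ⟨⟨i', hi'⟩, b⟩) h <;> simp [pooledEntry] at h ⊢
  · exact h
  · exact absurd h.1.symm hi'.2
  · exact absurd h.1 hi.2
  · exact h

lemma card_pool {D : Finset (Fin M)} {j : Fin M} (hj : j ∉ D) :
    Fintype.card {i : Fin M // i ∉ D ∧ i ≠ j} = M - D.card - 1 := by
  rw [Fintype.card_subtype]
  have : Finset.univ.filter (fun i : Fin M => i ∉ D ∧ i ≠ j) = (insert j D)ᶜ := by
    ext i; simp [and_comm]
  rw [this, Finset.card_compl, Finset.card_insert_of_notMem hj, Fintype.card_fin]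
  omega

variable {k : ℝ → ℝ → ℝ}

/-- The law of the entries entering `pooledMMDSq k D j`. -/
noncomputable def pooledLaw (fN fA : ℝ → ℝ) (n : ℕ) (B D : Finset (Fin M)) (j : Fin M) :
    Fin n ⊕ ({i : Fin M // i ∉ D ∧ i ≠ j} × Fin n) → Measure ℝ :=
  fun a => if (pooledEntry D j a).1 ∈ B then law fA else law fN

lemma isProbabilityMeasure_pooledLaw (hfN : IsPDF fN) (hfA : IsPDF fA) (B D : Finset (Fin M))
    (j : Fin M) (a) : IsProbabilityMeasure (pooledLaw fN fA n B D j a) := by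
  have := hfN.isProbabilityMeasure_law
  have := hfA.isProbabilityMeasure_law
  unfold pooledLaw
  split_ifs <;> assumption

/-- The pooled discrepancy is sub-Gaussian under the data law: the `n` entries of the `j`-th sequence
contribute `1 / n` to the variance proxy, the `q * n` entries of the pool `1 / (q * n)`. -/
lemma IsBoundedKernel.hasSubgaussianMGF_pooledMMDSq (hk : IsBoundedKernel k) (hfN : IsPDF fN)
    (hfA : IsPDF fA) (B : Finset (Fin M)) {D : Finset (Fin M)} {j : Fin M} (hj : j ∉ D)
    (hD : D.card + 2 ≤ M) (hn : 2 ≤ n) :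
    ∃ c : ℝ≥0, (c : ℝ) = 16 * kernelMax k ^ 2 * (1 + 1 / ((M : ℝ) - D.card - 1)) / n ∧
      HasSubgaussianMGF
        (fun y => pooledMMDSq k D j y - ∫ z, jointMMDSq k z ∂(Measure.pi (pooledLaw fN fA n B D j)))
        c (dataLaw fN fA n B) := by
  have := fun a => isProbabilityMeasure_pooledLaw (n := n) hfN hfA B D j a
  set q := M - D.card - 1 with hq
  have hq1 : 1 ≤ q := by omega
  have hqr : (M : ℝ) - D.card - 1 = q := by
    rw [hq, Nat.sub_sub, Nat.cast_sub (by omega)]; push_cast; ring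
  have hcard : Fintype.card ({i : Fin M // i ∉ D ∧ i ≠ j} × Fin n) = q * n := by
    rw [Fintype.card_prod, card_pool hj, Fintype.card_fin]
  have h2 : 2 ≤ Fintype.card ({i : Fin M // i ∉ D ∧ i ≠ j} × Fin n) := by
    rw [hcard]; nlinarith
  have h2' : 2 ≤ Fintype.card (Fin n) := by simpa using hn
  have : Nonempty (Fin n) := ⟨⟨0, by omega⟩⟩
  have : Nonempty ({i : Fin M // i ∉ D ∧ i ≠ j} × Fin n) :=
    Fintype.card_pos_iff.1 (by omega)
  refine ⟨_, (hk.sum_mmdSqOscillation (ι := Fin n)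
    (κ := {i : Fin M // i ∉ D ∧ i ≠ j} × Fin n)).trans ?_, ?_⟩
  · rw [hcard, hqr, Fintype.card_fin]
    have : (0 : ℝ) < n := by exact_mod_cast (by omega : 0 < n)
    have : (0 : ℝ) < q := by exact_mod_cast hq1
    push_cast
    field_simp
  · have h := (hk.hasBoundedDifferences_jointMMDSq h2' h2).hasSubgaussianMGF
      (μ := pooledLaw fN fA n B D j) hk.measurable_jointMMDSq
    have hmap := dataLaw_map_entries hfN hfA B _ (pooledEntry_injective (n := n) D j)
    change _ = Measure.pi (pooledLaw fN fA n B D j) at hmap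
    nth_rewrite 2 [← hmap] at h
    refine HasSubgaussianMGF.of_map (Measurable.aemeasurable ?_) h
    fun_prop

/-- Exceeding `lam` is exponentially unlikely for the discrepancy of nominal sequences. -/
lemma IsBoundedKernel.measureReal_pooledMMDSq_gt_le (hk : IsBoundedKernel k) (hfN : IsPDF fN)
    (hfA : IsPDF fA) {B D : Finset (Fin M)} (hBD : B ⊆ D) {j : Fin M} (hj : j ∉ D)
    (hD : D.card + 2 ≤ M) (hn : 2 ≤ n) {lam : ℝ} (hlam : 0 < lam) :
    (dataLaw fN fA n B).real {y | lam < pooledMMDSq k D j y}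
      ≤ Real.exp (-(n * g₁ k M D.card lam)) := by
  have := isProbabilityMeasure_dataLaw (n := n) hfN hfA B
  have := fun a => isProbabilityMeasure_pooledLaw (n := n) hfN hfA B D j a
  obtain ⟨c, hc, h⟩ := hk.hasSubgaussianMGF_pooledMMDSq hfN hfA B hj hD hn
  have hmean : ∫ z, jointMMDSq k z ∂(Measure.pi (pooledLaw fN fA n B D j)) = 0 := by
    refine hk.integral_jointMMDSq_of_eq (by simpa using hn) ?_ _ (law fN) ?_
    · rw [Fintype.card_prod, card_pool hj, Fintype.card_fin]
      have : 1 ≤ M - D.card - 1 := by omega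
      nlinarith
    · rintro (a | ⟨⟨i, hi⟩, a⟩)
      · exact if_neg fun h => hj (hBD h)
      · exact if_neg fun h => hi.1 (hBD h)
  rw [hmean] at h
  refine (measureReal_mono fun y hy => ?_).trans ((h.measure_ge_le hlam.le).trans_eq ?_)
  · have : lam < pooledMMDSq k D j y := hy
    simpa using this.le
  · rw [hc, g₁]
    congr 1
    rw [neg_div, neg_inj, mul_div_assoc', ← mul_div_assoc, div_div_eq_mul_div]
    ring_nf

/-- Falling below `lam` is exponentially unlikely for a discrepancy whose mean is at least
`w > lam`. -/
lemma IsBoundedKernel.measureReal_pooledMMDSq_le_le (hk : IsBoundedKernel k) (hfN : IsPDF fN)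
    (hfA : IsPDF fA) {B D : Finset (Fin M)} {j : Fin M} (hj : j ∉ D)
    (hD : D.card + 2 ≤ M) (hn : 2 ≤ n) {lam w : ℝ} (hlam : lam < w)
    (hw : w ≤ ∫ z, jointMMDSq k z ∂(Measure.pi (pooledLaw fN fA n B D j))) :
    (dataLaw fN fA n B).real {y | pooledMMDSq k D j y ≤ lam}
      ≤ Real.exp (-(n * ((w - lam) ^ 2
          / (32 * kernelMax k ^ 2 * (1 + 1 / ((M : ℝ) - D.card - 1)))))) := by
  have := isProbabilityMeasure_dataLaw (n := n) hfN hfA B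
  obtain ⟨c, hc, h⟩ := hk.hasSubgaussianMGF_pooledMMDSq hfN hfA B hj hD hn
  refine (measureReal_mono fun y hy => ?_).trans
    ((h.neg.measure_ge_le (sub_nonneg.2 hlam.le)).trans_eq ?_)
  · have : pooledMMDSq k D j y ≤ lam := hy
    simp only [Set.mem_ofPred_eq, Pi.neg_apply]
    linarith
  · rw [hc]
    congr 1
    rw [neg_div, neg_inj, mul_div_assoc', ← mul_div_assoc, div_div_eq_mul_div]
    ring_nf

/-- The mean when `j` is an outlier: besides `j`, `|B \ D| - 1` outliers are in the pool. -/
lemma IsBoundedKernel.integral_pooledMMDSq_of_mem (hk : IsBoundedKernel k) (hfN : IsPDF fN)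
    (hfA : IsPDF fA) {B D : Finset (Fin M)} {j : Fin M} (hjB : j ∈ B) (hj : j ∉ D)
    (hD : D.card + 2 ≤ M) (hn : 2 ≤ n) :
    ∫ z, jointMMDSq k z ∂(Measure.pi (pooledLaw fN fA n B D j))
      = mmdSq k fN fA * (1 - 2 * ((((B \ D).card - 1 : ℕ) * n : ℝ) / ((M - D.card - 1 : ℕ) * n))
        + (((B \ D).card - 1 : ℕ) * n : ℝ) * (((B \ D).card - 1 : ℕ) * n - 1)
          / (((M - D.card - 1 : ℕ) * n) * ((M - D.card - 1 : ℕ) * n - 1))) := by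
  have := hfN.isProbabilityMeasure_law
  have := hfA.isProbabilityMeasure_law
  have := fun a => isProbabilityMeasure_pooledLaw (n := n) hfN hfA B D j a
  have hcard : Fintype.card ({i : Fin M // i ∉ D ∧ i ≠ j} × Fin n) = (M - D.card - 1) * n := by
    rw [Fintype.card_prod, card_pool hj, Fintype.card_fin]
  have hR : (Finset.univ.filter
      fun p : {i : Fin M // i ∉ D ∧ i ≠ j} × Fin n => p.1.1 ∈ B).card
      = ((B \ D).card - 1) * n := by
    have h1 : (Finset.univ.filter fun p : {i : Fin M // i ∉ D ∧ i ≠ j} × Fin n => p.1.1 ∈ B)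
        = (Finset.univ.filter fun i : {i : Fin M // i ∉ D ∧ i ≠ j} => i.1 ∈ B) ×ˢ Finset.univ := by
      ext p; simp
    have h2 : (Finset.univ.filter fun i : {i : Fin M // i ∉ D ∧ i ≠ j} => i.1 ∈ B).map
        (Function.Embedding.subtype _) = (B \ D).erase j := by
      ext i
      simp
      tauto
    rw [h1, Finset.card_product, ← Finset.card_map (Function.Embedding.subtype _), h2,
      Finset.card_erase_of_mem (by simp [hjB, hj])]
    simp
  rw [hk.integral_jointMMDSq_mixture (by simpa using hn) ?_ (pooledLaw fN fA n B D j) (law fA)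
    (law fN) (fun p => p.1.1 ∈ B) (fun i => by simp [pooledLaw, pooledEntry, hjB])
    (fun i => by simp [pooledLaw, pooledEntry]; congr) hR, hcard, mmdSq_eq_kernelMean]
  · push_cast; rfl
  · rw [hcard]
    have : 1 ≤ M - D.card - 1 := by omega
    nlinarith

end Data

/-! ### Error events of the test -/

section Events

variable {k : ℝ → ℝ → ℝ} {M n T : ℕ} {lam : ℝ} {B D : Finset (Fin M)}
  {I : ℕ → (Fin M → Fin n → ℝ) → Finset (Fin M)} {y : Fin M → Fin n → ℝ}

lemma mem_setsOfSize {t : ℕ} : D ∈ setsOfSize M t ↔ D.card = t := by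
  simp [setsOfSize, Finset.mem_powersetCard]

lemma exists_superset_card_eq_ne {t : ℕ} (h1 : B.card < t) (h2 : t < M) (J : Finset (Fin M)) :
    ∃ D ∈ setsOfSize M t, B ⊆ D ∧ D ≠ J := by
  obtain ⟨D, hBD, -, hD⟩ := Finset.exists_subsuperset_card_eq (Finset.subset_univ B) h1.le
    (by simpa using h2.le)
  by_cases hDJ : D = J
  · obtain ⟨a, haD, haB⟩ := Finset.exists_mem_notMem_of_card_lt_card (hD ▸ h1)
    obtain ⟨b, -, hbD⟩ := Finset.exists_mem_notMem_of_card_lt_card (s := D) (t := Finset.univ)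
      (by simpa [hD] using h2)
    refine ⟨insert b (D.erase a), ?_, ?_, ?_⟩
    · rw [mem_setsOfSize, Finset.card_insert_of_notMem (by simp [hbD]),
        Finset.card_erase_of_mem haD]
      omega
    · exact fun i hi => Finset.mem_insert_of_mem
        (Finset.mem_erase.2 ⟨fun h => haB (h ▸ hi), hBD hi⟩)
    · rintro rfl
      exact hbD (hDJ ▸ Finset.mem_insert_self b _)
  · exact ⟨D, mem_setsOfSize.2 hD, hBD, hDJ⟩

lemma exists_lt_pooledMMDSq (hD : D.card < M) (h : lam < score k D y) :
    ∃ j, j ∉ D ∧ lam < pooledMMDSq k D j y := by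
  obtain ⟨b, -, hbD⟩ := Finset.exists_mem_notMem_of_card_lt_card (s := D) (t := Finset.univ)
    (by simpa using hD)
  have : Nonempty {j : Fin M // j ∉ D} := ⟨⟨b, hbD⟩⟩
  obtain ⟨j, hj⟩ := exists_lt_of_lt_ciSup h
  exact ⟨j.1, j.2, hj⟩

lemma pooledMMDSq_le_score {j : Fin M} (hj : j ∉ D) : pooledMMDSq k D j y ≤ score k D y :=
  le_ciSup (f := fun j : {j : Fin M // j ∉ D} => pooledMMDSq k D j.1 y)
    (Set.finite_range _).bddAbove ⟨j, hj⟩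

lemma secondScore_le_score {t : ℕ} (hD : D ∈ setsOfSize M t) (hDI : D ≠ I t y) :
    secondScore k I t y ≤ score k D y :=
  ciInf_le (f := fun D : {D : Finset (Fin M) // D ∈ setsOfSize M t ∧ D ≠ I t y} => score k D.1 y)
    (Set.finite_range _).bddBelow ⟨D, hD, hDI⟩

lemma exists_score_eq_secondScore {t : ℕ} (ht : 1 ≤ t) (htM : t < M) :
    ∃ D ∈ setsOfSize M t, D ≠ I t y ∧ score k D y = secondScore k I t y := by
  obtain ⟨D₀, h₀, -, h₀I⟩ := exists_superset_card_eq_ne (B := ∅) (Finset.card_empty.trans_lt ht) htM (I t y)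
  have : Nonempty {D : Finset (Fin M) // D ∈ setsOfSize M t ∧ D ≠ I t y} := ⟨⟨D₀, h₀, h₀I⟩⟩
  obtain ⟨D, hD⟩ := exists_eq_ciInf_of_finite
    (f := fun D : {D : Finset (Fin M) // D ∈ setsOfSize M t ∧ D ≠ I t y} => score k D.1 y)
  exact ⟨D.1, D.2.1, D.2.2, hD⟩

lemma estimate_spec (h : estimate k T lam I y ≠ 0) :
    1 ≤ estimate k T lam I y ∧ estimate k T lam I y ≤ T ∧
      lam < secondScore k I (estimate k T lam I y) y := by
  classical
  have hne : ((Finset.Icc 1 T).filter fun t => lam < secondScore k I t y).Nonempty := by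
    by_contra hne
    refine h (Nat.le_zero.1 ?_)
    unfold estimate
    refine Finset.sup_le fun t ht => ?_
    exact absurd ⟨t, Finset.mem_filter.2 (Finset.mem_filter.1 ht)⟩ hne
  obtain ⟨t, ht, hte⟩ := Finset.exists_mem_eq_sup _ hne id
  have he : estimate k T lam I y = t := by
    rw [← show _ = t from hte]
    unfold estimate
    congr
  rw [he]
  simpa [and_assoc] using ht

lemma secondScore_le_of_estimate_lt {s : ℕ} (hs1 : 1 ≤ s) (hsT : s ≤ T)
    (h : estimate k T lam I y < s) : secondScore k I s y ≤ lam := by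
  by_contra! hlt
  refine h.not_ge ?_
  unfold estimate
  exact Finset.le_sup (f := id) (by simp [hs1, hsT, hlt])

/-- Some discrepancy which, if `B` is the set of outliers, compares nominal sequences only,
exceeds `lam`. -/
def nominalExceeds (k : ℝ → ℝ → ℝ) (n T : ℕ) (lam : ℝ) (B : Finset (Fin M)) :
    Set (Fin M → Fin n → ℝ) :=
  {y | ∃ D j, (B ⊆ D ∧ D.card ≤ T ∧ j ∉ D) ∧ lam < pooledMMDSq k D j y}

/-- Some wrong set of the size of `B` has score at most `lam`. -/
def wrongSetPasses (k : ℝ → ℝ → ℝ) (n : ℕ) (lam : ℝ) (B : Finset (Fin M)) :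
    Set (Fin M → Fin n → ℝ) :=
  {y | ∃ C ∈ setsOfSize M B.card, C ≠ B ∧ score k C y ≤ lam}

/-- Overestimating the number of outliers: two sets of the estimated size contain `B`, so one of
them is not the minimizer and its score exceeds `lam`. -/
lemma mem_nominalExceeds_of_card_lt (hTM : T < M) (h : B.card < estimate k T lam I y) :
    y ∈ nominalExceeds k n T lam B := by
  obtain ⟨-, hT, hlt⟩ := estimate_spec (by omega : estimate k T lam I y ≠ 0)
  obtain ⟨D, hD, hBD, hDI⟩ := exists_superset_card_eq_ne h (by omega)
    (I (estimate k T lam I y) y)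
  have hc := mem_setsOfSize.1 hD
  obtain ⟨j, hj, hjlt⟩ := exists_lt_pooledMMDSq (by omega)
    (hlt.trans_le (secondScore_le_score hD hDI))
  exact ⟨D, j, ⟨hBD, by omega, hj⟩, hjlt⟩

/-- Underestimating the number of outliers: the second smallest score among the sets of the true
size is at most `lam`, and one of the two best sets is wrong. -/
lemma mem_wrongSetPasses_of_lt_card (hTM : T < M) (hI : IsArgminScore k T I) (hB1 : 1 ≤ B.card)
    (hBT : B.card ≤ T) (h : estimate k T lam I y < B.card) :
    y ∈ wrongSetPasses k n lam B := by
  obtain ⟨D, hD, hDI, hDs⟩ := exists_score_eq_secondScore (k := k) (I := I) (y := y) hB1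
    (by omega)
  have hle := secondScore_le_of_estimate_lt hB1 hBT h
  by_cases hDB : D = B
  · subst hDB
    obtain ⟨h1, h2⟩ := hI D.card (Finset.mem_Icc.2 ⟨hB1, hBT⟩) y
    exact ⟨_, h1, hDI.symm, (h2 D hD).trans (hDs.trans_le hle)⟩
  · exact ⟨D, hD, hDB, hDs.trans_le hle⟩

lemma test_eq_none_iff : test k T lam I y = none ↔ estimate k T lam I y = 0 := by
  unfold test
  split_ifs with h <;> simp [h]

/-- A misclassification has one of the two causes, and underestimating the number of outliers by a
positive number is possible only if there are at least two of them. -/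
lemma mem_of_misclassified (hTM : T < M) (hI : IsArgminScore k T I) (hB1 : 1 ≤ B.card)
    (hBT : B.card ≤ T) (h : test k T lam I y ≠ some B) (h0 : test k T lam I y ≠ none) :
    y ∈ nominalExceeds k n T lam B ∨ (1 < B.card ∧ y ∈ wrongSetPasses k n lam B) := by
  have he : estimate k T lam I y ≠ 0 := fun he => h0 (test_eq_none_iff.2 he)
  rcases lt_trichotomy (estimate k T lam I y) B.card with hlt | heq | hgt
  · exact Or.inr ⟨by omega, mem_wrongSetPasses_of_lt_card hTM hI hB1 hBT hlt⟩
  · left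
    have hBI : B ≠ I (estimate k T lam I y) y := by
      intro hBI
      apply h
      rw [test, if_neg he, ← hBI]
    obtain ⟨j, hj, hjlt⟩ := exists_lt_pooledMMDSq (by omega)
      ((estimate_spec he).2.2.trans_le (secondScore_le_score (mem_setsOfSize.2 heq.symm) hBI))
    exact ⟨B, j, ⟨subset_rfl, hBT, hj⟩, hjlt⟩
  · exact Or.inl (mem_nominalExceeds_of_card_lt hTM hgt)

end Events

/-! ### Exponents -/

section Exponents

/-- A constant factor, such as the number of events in a union bound, does not affect the
exponent. -/
lemma le_exponent {p : ℕ → ENNReal} {C g : ℝ} (hC : 0 < C)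
    (h : ∀ᶠ n : ℕ in atTop, p n ≤ ENNReal.ofReal (C * Real.exp (-(n * g)))) :
    (g : EReal) ≤ exponent p := by
  have hlim : Tendsto (fun n : ℕ => ((g - Real.log C / n : ℝ) : EReal)) atTop (nhds (g : EReal)) := by
    refine (continuous_coe_real_ereal.tendsto g).comp ?_
    simpa using (tendsto_const_nhds (x := g)).sub
      (tendsto_const_div_atTop_nhds_zero_nat (Real.log C))
  rw [← hlim.liminf_eq]
  refine liminf_le_liminf ?_
  filter_upwards [h, eventually_ge_atTop 1] with n hn hn1
  have hn0 : (0 : ℝ) < n := by exact_mod_cast hn1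
  rw [EReal.le_div_iff_mul_le (by exact_mod_cast hn0) (EReal.natCast_ne_top n)]
  have h1 := ENNReal.log_le_log hn
  rw [ENNReal.log_ofReal_of_pos (by positivity), Real.log_mul hC.ne' (Real.exp_ne_zero _),
    Real.log_exp] at h1
  refine le_trans (le_of_eq ?_) (EReal.neg_le_neg_iff.2 h1)
  norm_cast
  field_simp
  ring

variable {k : ℝ → ℝ → ℝ} {fN fA : ℝ → ℝ} {M T : ℕ} {lam : ℝ}

lemma g₁_anti {t : ℕ} (htT : t ≤ T) (hTM : T + 2 ≤ M) : g₁ k M T lam ≤ g₁ k M t lam := by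
  have h1 : (t : ℝ) ≤ T := by exact_mod_cast htT
  have h2 : (T : ℝ) + 2 ≤ M := by exact_mod_cast hTM
  unfold g₁
  rcases eq_or_ne (kernelMax k) 0 with h0 | h0
  · simp [h0]
  · have h3 : (0 : ℝ) < (M : ℝ) - T - 1 := by linarith
    have h4 : (0 : ℝ) < (M : ℝ) - t - 1 := by linarith
    gcongr

lemma IsBoundedKernel.measureReal_nominalExceeds_le (hk : IsBoundedKernel k) (hfN : IsPDF fN)
    (hfA : IsPDF fA) (hTM : T + 2 ≤ M) (B : Finset (Fin M)) {n : ℕ} (hn : 2 ≤ n)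
    (hlam : 0 < lam) :
    (dataLaw fN fA n B).real (nominalExceeds k n T lam B)
      ≤ Fintype.card (Finset (Fin M) × Fin M) * Real.exp (-(n * g₁ k M T lam)) := by
  have := isProbabilityMeasure_dataLaw (n := n) hfN hfA B
  have hset : nominalExceeds k n T lam B = ⋃ p : Finset (Fin M) × Fin M,
      {y | (B ⊆ p.1 ∧ p.1.card ≤ T ∧ p.2 ∉ p.1) ∧ lam < pooledMMDSq k p.1 p.2 y} := by
    ext y
    simp [nominalExceeds]
  rw [hset]
  refine (measureReal_iUnion_fintype_le _).trans
    ((Finset.sum_le_sum (g := fun _ => Real.exp (-(n * g₁ k M T lam))) fun p _ => ?_).trans_eq ?_)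
  · by_cases hp : B ⊆ p.1 ∧ p.1.card ≤ T ∧ p.2 ∉ p.1
    · simp only [hp, true_and, not_false_eq_true, and_self]
      refine (hk.measureReal_pooledMMDSq_gt_le hfN hfA hp.1 hp.2.2 (by omega) hn hlam).trans ?_
      have := g₁_anti (k := k) (lam := lam) hp.2.1 hTM
      gcongr
    · simp only [hp, false_and]
      simp [Real.exp_nonneg]
  · simp

/-- If all the means of discrepancies between an outlier and a pool with fewer than `|B|` outliers
are eventually at least `w`, then a wrong set passes with exponentially small probability. -/
lemma IsBoundedKernel.eventually_measureReal_wrongSetPasses_le (hk : IsBoundedKernel k)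
    (hfN : IsPDF fN) (hfA : IsPDF fA) {B : Finset (Fin M)} (hBM : B.card + 2 ≤ M) {w : ℝ}
    (hlam : lam < w)
    (hw : ∀ r < B.card, ∀ᶠ n : ℕ in atTop,
      w ≤ mmdSq k fN fA * (1 - 2 * ((r * n : ℝ) / ((M - B.card - 1 : ℕ) * n))
        + (r * n : ℝ) * (r * n - 1)
          / (((M - B.card - 1 : ℕ) * n) * ((M - B.card - 1 : ℕ) * n - 1)))) :
    ∀ᶠ n : ℕ in atTop, (dataLaw fN fA n B).real (wrongSetPasses k n lam B)
      ≤ Fintype.card (Finset (Fin M)) * Real.exp (-(n * ((w - lam) ^ 2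
          / (32 * kernelMax k ^ 2 * (1 + 1 / ((M : ℝ) - B.card - 1)))))) := by
  have hw' := (eventually_all_finset (Finset.range B.card)).2
    fun r hr => hw r (Finset.mem_range.1 hr)
  filter_upwards [hw', eventually_ge_atTop 2] with n hwn hn
  have := isProbabilityMeasure_dataLaw (n := n) hfN hfA B
  have hset : wrongSetPasses k n lam B = ⋃ C : Finset (Fin M),
      {y | (C.card = B.card ∧ C ≠ B) ∧ score k C y ≤ lam} := by
    ext y
    simp [wrongSetPasses, mem_setsOfSize, and_assoc]
  rw [hset]
  refine (measureReal_iUnion_fintype_le _).trans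
    ((Finset.sum_le_sum (g := fun _ => Real.exp (-(n * ((w - lam) ^ 2
      / (32 * kernelMax k ^ 2 * (1 + 1 / ((M : ℝ) - B.card - 1)))))))
      fun C _ => ?_).trans_eq (by simp))
  by_cases hC : C.card = B.card ∧ C ≠ B
  · -- an outlier which `C` misses
    obtain ⟨j, hjB, hjC⟩ : ∃ j ∈ B, j ∉ C := by
      by_contra! hsub
      exact hC.2 (Finset.eq_of_subset_of_card_le hsub hC.1.le).symm
    have hpos : 1 ≤ (B \ C).card :=
      Finset.card_pos.2 ⟨j, Finset.mem_sdiff.2 ⟨hjB, hjC⟩⟩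
    have hle : (B \ C).card ≤ B.card := Finset.card_le_card Finset.sdiff_subset
    have hmean := hwn ((B \ C).card - 1) (Finset.mem_range.2 (by omega))
    rw [← hC.1, ← hk.integral_pooledMMDSq_of_mem hfN hfA hjB hjC (by omega) hn] at hmean
    rw [← hC.1]
    refine le_trans (measureReal_mono fun y hy => ?_)
      (hk.measureReal_pooledMMDSq_le_le hfN hfA hjC (by omega) hn hlam hmean)
    exact (pooledMMDSq_le_score hjC).trans hy.2
  · simp only [hC, false_and]
    simp [Real.exp_nonneg]

/-- The mean of the discrepancy between an outlier and a pool of `q` sequences, `r` of which are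
outliers, tends to `(1 - r / q) ^ 2 * d`, which exceeds `(1 - s / q) ^ 2 * d` if `r < s ≤ q`. -/
lemma eventually_le_mixture_mean {d : ℝ} (hd : 0 < d) {r s q : ℕ} (hrs : r < s) (hsq : s ≤ q) :
    ∀ᶠ n : ℕ in atTop, (1 - (s : ℝ) / q) ^ 2 * d
      ≤ d * (1 - 2 * ((r * n : ℝ) / (q * n))
        + (r * n : ℝ) * (r * n - 1) / ((q * n) * (q * n - 1))) := by
  have hrs' : (r : ℝ) < s := by exact_mod_cast hrs
  have hsq' : (s : ℝ) ≤ q := by exact_mod_cast hsq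
  have hr0 : (0 : ℝ) ≤ r := by positivity
  have hq : (0 : ℝ) < q := by linarith
  have hlt : (1 - (s : ℝ) / q) ^ 2 < (1 - (r : ℝ) / q) ^ 2 := by
    have h1 : (r : ℝ) / q < s / q := by gcongr
    have h2 : (s : ℝ) / q ≤ 1 := (div_le_one hq).2 hsq'
    exact pow_lt_pow_left₀ (by linarith) (by linarith) (by norm_num)
  have hden : Tendsto (fun n : ℕ => (q : ℝ) * n - 1) atTop atTop :=
    tendsto_atTop_add_const_right _ (-1) (tendsto_natCast_atTop_atTop.const_mul_atTop hq)
  have hlim : Tendsto (fun n : ℕ => (1 - (r : ℝ) / q) ^ 2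
      - (r : ℝ) / q * (1 - r / q) / ((q : ℝ) * n - 1)) atTop (nhds ((1 - (r : ℝ) / q) ^ 2)) := by
    simpa using (tendsto_const_nhds (x := (1 - (r : ℝ) / q) ^ 2)).sub
      (hden.const_div_atTop ((r : ℝ) / q * (1 - r / q)))
  filter_upwards [hlim.eventually_const_lt hlt, hden.eventually_gt_atTop 0,
    eventually_ge_atTop 1] with n hn hqn hn1
  have hn0 : (0 : ℝ) < n := by exact_mod_cast hn1
  -- the exact mean is `(1 - r / q) ^ 2 - (r / q) * (1 - r / q) / (q * n - 1)`, times `d`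
  rw [mul_comm]
  refine mul_le_mul_of_nonneg_left (hn.le.trans_eq ?_) hd.le
  field_simp
  ring

end Exponents

end OutlierTest

theorem theorem4 (k : ℝ → ℝ → ℝ) (hk : IsBoundedKernel k)
    (fN fA : ℝ → ℝ) (hfN : IsPDF fN) (hfA : IsPDF fA)
    (M T : ℕ) (hT1 : 1 ≤ T) (hT : T ≤ M ⌈/⌉ 2 - 1)
    (lam : ℝ) (hlam : 0 < lam)
    (I : (n : ℕ) → ℕ → (Fin M → Fin n → ℝ) → Finset (Fin M))
    (hI : ∀ n, IsArgminScore k T (I n)) :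
    (∀ s : ℕ, 1 < s → s ≤ T →
      lam < (1 - (s : ℝ) / ((M : ℝ) - s - 1)) ^ 2 * mmdSq k fN fA →
      ∀ B ∈ setsOfSize M s,
        ((min (g₁ k M T lam) (g₂ k fN fA M s lam) : ℝ) : EReal)
            ≤ exponent (fun n => misclassification fN fA B (test k T lam (I n))) ∧
        ((g₂ k fN fA M s lam : ℝ) : EReal)
            ≤ exponent (fun n => falseReject fN fA B (test k T lam (I n)))) ∧
    (lam < mmdSq k fN fA →
      ∀ B ∈ setsOfSize M 1,
        ((g₁ k M T lam : ℝ) : EReal)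
            ≤ exponent (fun n => misclassification fN fA B (test k T lam (I n))) ∧
        (((mmdSq k fN fA - lam) ^ 2
              / (32 * kernelMax k ^ 2 * (1 + 1 / ((M : ℝ) - 2))) : ℝ) : EReal)
            ≤ exponent (fun n => falseReject fN fA B (test k T lam (I n)))) ∧
    ((g₁ k M T lam : ℝ) : EReal)
      ≤ exponent (fun n => falseAlarm fN fA (test k T lam (I n))) := by
  -- `T ≤ ⌈M / 2⌉ - 1` says that the sequences outside a set of size `T` outnumber it by
  -- at least one
  obtain ⟨hM1, hM2⟩ : T < M ∧ 2 * T + 1 ≤ M := by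
    rw [Nat.ceilDiv_eq_add_pred_div] at hT
    omega
  have hpos : (0 : ℝ) < Fintype.card (Finset (Fin M) × Fin M) := by
    have : Nonempty (Fin M) := ⟨⟨0, by omega⟩⟩
    exact_mod_cast Fintype.card_pos
  have hpos' : (0 : ℝ) < Fintype.card (Finset (Fin M)) := by
    exact_mod_cast Fintype.card_pos
  have hprob := fun n (B : Finset (Fin M)) => isProbabilityMeasure_dataLaw (n := n) hfN hfA B
  have hle : ∀ {n : ℕ} {B : Finset (Fin M)} {S : Set (Fin M → Fin n → ℝ)} {b : ℝ},
      (dataLaw fN fA n B).real S ≤ b → dataLaw fN fA n B S ≤ ENNReal.ofReal b :=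
    fun h => by
      rw [← ofReal_measureReal]
      exact ENNReal.ofReal_le_ofReal h
  -- the false reject event forces a wrong set to pass
  have hreject : ∀ {B : Finset (Fin M)}, 1 ≤ B.card → B.card ≤ T → ∀ {n : ℕ},
      {y | test k T lam (I n) y = none} ⊆ wrongSetPasses k n lam B := fun hB1 hBT n y hy =>
    mem_wrongSetPasses_of_lt_card hM1 (hI n) hB1 hBT (by
      rw [test_eq_none_iff.1 hy]
      omega)
  refine ⟨fun s hs1 hsT hlt B hB => ?_, fun hlt B hB => ?_, ?_⟩
  · obtain rfl := mem_setsOfSize.1 hB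
    have hq : ((M - B.card - 1 : ℕ) : ℝ) = (M : ℝ) - B.card - 1 := by
      rw [Nat.sub_sub, Nat.cast_sub (by omega)]; push_cast; ring
    have hd : 0 < mmdSq k fN fA := by
      by_contra! hd
      nlinarith [mul_nonpos_of_nonneg_of_nonpos
        (sq_nonneg (1 - (B.card : ℝ) / ((M : ℝ) - B.card - 1))) hd]
    have hwrong := hk.eventually_measureReal_wrongSetPasses_le hfN hfA (B := B) (by omega) hlt
      fun r hr => by
        rw [← hq]
        exact eventually_le_mixture_mean hd hr (by omega)
    constructor
    · refine le_exponent (add_pos hpos hpos') ?_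
      filter_upwards [hwrong, eventually_ge_atTop 2] with n hn hn2
      have hnom := hk.measureReal_nominalExceeds_le hfN hfA (T := T) (by omega) B hn2 hlam
      refine hle ((measureReal_mono (s₂ := nominalExceeds k n T lam B ∪ wrongSetPasses k n lam B)
        fun y hy => ?_).trans ((measureReal_union_le _ _).trans ((add_le_add hnom hn).trans ?_)))
      · exact (mem_of_misclassified hM1 (hI n) hs1.le hsT hy.1 hy.2).imp id And.right
      · rw [add_mul]
        gcongr
        · exact min_le_left _ _
        · exact min_le_right _ _
    · refine le_exponent hpos' ?_
      filter_upwards [hwrong] with n hn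
      exact hle ((measureReal_mono (hreject hs1.le hsT)).trans hn)
  · have hB' := mem_setsOfSize.1 hB
    constructor
    · refine le_exponent hpos ?_
      filter_upwards [eventually_ge_atTop 2] with n hn2
      refine hle ((measureReal_mono fun y hy => ?_).trans
        (hk.measureReal_nominalExceeds_le hfN hfA (T := T) (by omega) B hn2 hlam))
      refine (mem_of_misclassified hM1 (hI n) hB'.ge (by omega) hy.1 hy.2).resolve_right ?_
      omega
    · -- a single outlier is compared with a purely nominal pool, so the mean is exact
      have hwrong := hk.eventually_measureReal_wrongSetPasses_le hfN hfA (B := B) (by omega) hlt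
        fun r hr => by
          obtain rfl : r = 0 := by omega
          simp
      refine le_exponent hpos' ?_
      filter_upwards [hwrong] with n hn
      refine hle ((measureReal_mono (hreject hB'.ge (by omega))).trans (hn.trans_eq ?_))
      rw [hB', show (M : ℝ) - (1 : ℕ) - 1 = M - 2 by push_cast; ring]
  · refine le_exponent hpos ?_
    filter_upwards [eventually_ge_atTop 2] with n hn2
    refine hle ((measureReal_mono fun y hy => ?_).trans
      (hk.measureReal_nominalExceeds_le hfN hfA (T := T) (by omega) ∅ hn2 hlam))
    exact mem_nominalExceeds_of_card_lt hM1
      (by simpa using Nat.pos_of_ne_zero fun h => hy (test_eq_none_iff.2 h))
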